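/- Let $G$ be a connected multigraph (finite, loops and multiple edges allowed) with $s$ vertices $t_1,\ldots,t_s$ and $m$ edges, and let $K$ be a finite field of characteristic $p$. The incidence matrix of $G$ over $K$ is the $s\times m$ matrix whose columns are the vectors $\mathbf e_i+\mathbf e_j$, one for each edge $\{t_i,t_j\}$ of $G$ (so $2\mathbf e_i$ for a loop at $t_i$). Let $C\subseteq K^m$ be the incidence matrix code of $G$, that is, the row space of this matrix, and let $C^\perp$ be its dual code. For a linear code $D\subseteq K^m$ and $1\le r\le\dim_K D$, let $\delta_r(D)$ be the $r$-th generalized Hamming weight of $D$, i.e. the minimum of $|\chi(D')|$ over the $r$-dimensional subspaces $D'$ of $D$, where $\chi(D')$ is the set of positions at which some vector of $D'$ is nonzero. A cycle of $G$ is a simple closed path (a loop is a cycle of length $1$, a pair of parallel links a cycle of length $2$). A cocycle of $G$ is a minimal set of edges whose removal increases the number of connected components of $G$. A bowtie of $G$ is the union of two odd cycles that meet in exactly one vertex and have no common edge, or the union of two vertex-disjoint odd cycles and a simple path that meets one cycle at each end and is otherwise disjoint from them. Cycles, cocycles and bowties are regarded as edge sets, and a family $C_1,\ldots,C_r$ of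 edge sets is non-redundant if $\bigcup_{i\ne j}C_i\subsetneq\bigcup_{i=1}^rC_i$ for $j=1,\ldots,r$. The following hold. (a) If $p=2$ or $G$ is bipartite, then for $1\le r\le m-s+1$ the weight $\delta_r(C^\perp)$ is the minimum number of edges in a union of $r$ non-redundant cycles of $G$, and for $1\le r\le s-1$ the weight $\delta_r(C)$ is the minimum number of edges in a union of $r$ non-redundant cocycles of $G$. (b) If $p\ne 2$, then for $1\le r\le m-s$ the weight $\delta_r(C^\perp)$ is the minimum number of edges in a union of $r$ non-redundant members of the collection of all even cycles and bowties of $G$. -/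

import Mathlib

namespace IncidenceCode

/-! ### Generalized Hamming weights of linear codes -/

section Codes

variable {K ι : Type*} [Field K]

/-- The support of a linear subspace of `K^ι`: the positions where some vector is nonzero. -/
def support (D : Submodule K (ι → K)) : Set ι :=
  {i | ∃ a ∈ D, a i ≠ 0}

/-- The `r`-th generalized Hamming weight of the linear code `C`: the minimum size of the support
of an `r`-dimensional subspace of `C`. -/
noncomputable def ghw (C : Submodule K (ι → K)) (r : ℕ) : ℕ :=
  sInf {n | ∃ D : Submodule K (ι → K), D ≤ C ∧ Module.finrank K D = r ∧ (support D).ncard = n}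

/-- The dual code, with respect to the standard bilinear form. -/
def dualCode [Fintype ι] (C : Submodule K (ι → K)) : Submodule K (ι → K) where
  carrier := {y | ∀ x ∈ C, x ⬝ᵥ y = 0}
  zero_mem' := by simp
  add_mem' {u v} hu hv x hx := by rw [dotProduct_add, hu x hx, hv x hx, add_zero]
  smul_mem' c y hy x hx := by rw [dotProduct_smul, hy x hx, smul_zero]

end Codes

section Multigraphs

variable {α β : Type*}

/-! ### The incidence matrix code of a multigraph -/

open Classical in
/-- The incidence matrix of a multigraph, with rows indexed by the vertices and columns by the
edges: the column of an edge with ends `x` and `y` is `e_x + e_y`, so the column of a loop at `x`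
is `2 e_x` (see `incidenceMatrix_col`). -/
noncomputable def incidenceMatrix (K : Type*) [Field K] (G : Graph α β) :
    Matrix G.vertexSet G.edgeSet K :=
  Matrix.of fun x e => if G.IsLoopAt e x then 2 else if G.Inc e x then 1 else 0

open Classical in
theorem incidenceMatrix_col (K : Type*) [Field K] (G : Graph α β) (e : G.edgeSet)
    (x y : G.vertexSet) (h : G.IsLink e x y) :
    (fun z => incidenceMatrix K G z e) = Pi.single x 1 + Pi.single y 1 := by
  funext z
  have hloop : G.IsLoopAt e z ↔ z = x ∧ z = y := by
    rw [← Graph.isLink_self_iff, h.isLink_iff]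
    simp only [Subtype.ext_iff]
    grind
  have hinc : G.Inc e z ↔ z = x ∨ z = y := by
    simp only [Graph.Inc, h.isLink_iff, Subtype.ext_iff]
    grind
  simp only [incidenceMatrix, Matrix.of_apply, hloop, hinc, Pi.add_apply, Pi.single_apply]
  by_cases hx : z = x <;> by_cases hy : z = y <;> simp [hx, hy] <;> grind

/-- The incidence matrix code of a multigraph over `K`: the row space of its incidence matrix. -/
noncomputable def incidenceCode (K : Type*) [Field K] (G : Graph α β) :
    Submodule K (G.edgeSet → K) :=
  Submodule.span K (Set.range (incidenceMatrix K G).row)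

/-! ### Cycles, paths and bowties

Cycles, bowties and cocycles are represented by their sets of edges. -/

/-- `W` and `X` are the vertex set and the edge set of a cycle (simple closed path) of length `n`
in `G`. A loop is a cycle of length 1 and a pair of parallel links is a cycle of length 2. The
addition in `i + 1` is modulo `n`. -/
def IsCycleOfLength (G : Graph α β) (n : ℕ) (W : Set α) (X : Set β) : Prop :=
  ∃ (_ : NeZero n) (v : Fin n → α) (e : Fin n → β),
    Function.Injective v ∧ Function.Injective e ∧ (∀ i, G.IsLink (e i) (v i) (v (i + 1))) ∧
    W = Set.range v ∧ X = Set.range e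

/-- `X` is the edge set of a cycle of `G`. -/
def IsCycle (G : Graph α β) (X : Set β) : Prop :=
  ∃ n W, IsCycleOfLength G n W X

/-- `X` is the edge set of a cycle of even length of `G`. -/
def IsEvenCycle (G : Graph α β) (X : Set β) : Prop :=
  ∃ n W, Even n ∧ IsCycleOfLength G n W X

/-- `W` and `X` are the vertex set and the edge set of an odd cycle of `G`. -/
def IsOddCycle (G : Graph α β) (W : Set α) (X : Set β) : Prop :=
  ∃ n, Odd n ∧ IsCycleOfLength G n W X

/-- `W` and `X` are the vertex set and the edge set of a simple path of `G` from `x` to `y`. -/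
def IsSimplePath (G : Graph α β) (x y : α) (W : Set α) (X : Set β) : Prop :=
  ∃ (n : ℕ) (v : Fin (n + 1) → α) (e : Fin n → β),
    Function.Injective v ∧ (∀ i : Fin n, G.IsLink (e i) (v i.castSucc) (v i.succ)) ∧
    v 0 = x ∧ v (Fin.last n) = y ∧ W = Set.range v ∧ X = Set.range e

/-- `X` is the edge set of a bowtie of `G`: the union of two odd cycles whose intersection is a
single vertex (in particular they have no common edge), or the union of two vertex-disjoint odd
cycles and a simple path which meets each of them exactly in one of its two ends. -/
def IsBowtie (G : Graph α β) (X : Set β) : Prop :=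
  ∃ W₁ X₁ W₂ X₂, IsOddCycle G W₁ X₁ ∧ IsOddCycle G W₂ X₂ ∧
    (((∃ x, W₁ ∩ W₂ = {x}) ∧ Disjoint X₁ X₂ ∧ X = X₁ ∪ X₂) ∨
      (Disjoint W₁ W₂ ∧ ∃ x y W X₃, IsSimplePath G x y W X₃ ∧ W ∩ W₁ = {x} ∧ W ∩ W₂ = {y} ∧
        X = X₁ ∪ X₂ ∪ X₃))

/-! ### Connectivity, cocycles and bipartiteness -/

/-- A multigraph is connected if it is nonempty and any two vertices are joined by a walk;
loops and multiplicities play no role for this. -/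
def IsConnected (G : Graph α β) : Prop :=
  G.toSimpleGraph.Connected

/-- The number of connected components of a multigraph (isolated vertices included). -/
noncomputable def numComponents (G : Graph α β) : ℕ :=
  Nat.card G.toSimpleGraph.ConnectedComponent

/-- A set of edges of `G` whose removal increases the number of connected components. -/
def IsCutset (G : Graph α β) (X : Set β) : Prop :=
  X ⊆ G.edgeSet ∧ numComponents G < numComponents (G.deleteEdges X)

/-- A cocycle (bond): a minimal cutset. -/
def IsCocycle (G : Graph α β) (X : Set β) : Prop :=
  Minimal (IsCutset G) X

/-- The vertices can be split into two parts such that every edge joins a vertex of one part to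
a vertex of the other; a bipartite multigraph has no loops. -/
def IsBipartite (G : Graph α β) : Prop :=
  ∃ A : Set α, ∀ e x y, G.IsLink e x y → (x ∈ A ↔ y ∉ A)

/-! ### Non-redundant families -/

/-- A family of sets is non-redundant if omitting any member makes the union strictly smaller. -/
def NonRedundant {r : ℕ} (F : Fin r → Set β) : Prop :=
  ∀ j, (⋃ i, ⋃ (_ : i ≠ j), F i) ⊂ ⋃ i, F i

/-- The numbers of edges of the unions of `r` non-redundant sets with property `P`. -/
def unionSizes (P : Set β → Prop) (r : ℕ) : Set ℕ :=
  {n | ∃ F : Fin r → Set β, (∀ i, P (F i)) ∧ NonRedundant F ∧ (⋃ i, F i).ncard = n}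

end Multigraphs

end IncidenceCode

namespace IncidenceCode

/-! ### Generalized Hamming weights from a family of supports. -/

section Weights

variable {K ι β : Type*} [Field K]

/-! All three formulas come from one principle, `isLeast_unionSizes_ghw`: it suffices to have a
family of sets that are supports of nonzero codewords, such that every nonzero codeword has a member
of the family inside its support. Members of a non-redundant family have private positions, so their
words are independent. Conversely, an `r`-dimensional subcode has `r` words that are diagonal at `r`
positions, and the member through the `j`-th position inside the `j`-th support misses the other
positions.

If `p = 2` or the graph is bipartite, there is a nowhere zero function `σ` with `σ x + σ y = 0`
along every edge. It makes every cycle carry a dual word and turns the words of the code into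
twisted differences `σ x * (f x - f y)`, whose supports are cutsets.

If `p ≠ 2`, the alternating sum of the edges around a closed path vanishes for even length and
leaves twice the base vertex for odd length; in a bowtie the connecting path, taken with weight 2,
cancels the two leftovers. For the converse, the support of a dual word has no dead end and no odd
cycle as a component (`exists_edge_off_odd_cycle`), and a walk leaving an odd cycle in such a set
closes up an even cycle or a bowtie (`exists_isEvenCycle_or_isBowtie`).

The ranges of `r` require only lower bounds on the dimensions of the codes. -/

theorem support_span_range {κ : Type*} (w : κ → ι → K) :
    support (Submodule.span K (Set.range w)) = ⋃ j, Function.support (w j) := by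
  ext i
  simp only [support, Set.mem_ofPred_eq, Set.mem_iUnion, Function.mem_support]
  refine ⟨fun ⟨a, ha, hai⟩ => ?_, fun ⟨j, hj⟩ =>
    ⟨w j, Submodule.subset_span (Set.mem_range_self j), hj⟩⟩
  by_contra! h
  have hle : Submodule.span K (Set.range w) ≤ LinearMap.ker (LinearMap.proj (R := K) i) := by
    rw [Submodule.span_le]
    rintro _ ⟨j, rfl⟩
    exact h j
  exact hai (hle ha)

/-- An `r`-dimensional space of vectors has `r` members which are diagonal at `r` positions. -/
theorem exists_diagonal_family [Finite ι] (r : ℕ) (D : Submodule K (ι → K))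
    (hr : r ≤ Module.finrank K D) :
    ∃ (p : Fin r → ι) (w : Fin r → ι → K), (∀ j, w j ∈ D) ∧ (∀ j, w j (p j) ≠ 0) ∧
      ∀ j k, j ≠ k → w j (p k) = 0 := by
  induction r generalizing D with
  | zero => exact ⟨Fin.elim0, Fin.elim0, fun j => j.elim0, fun j => j.elim0, fun j => j.elim0⟩
  | succ r ih =>
    have hD : D ≠ ⊥ := by
      rintro rfl
      simp at hr
    obtain ⟨w₀, hw₀, hne⟩ := D.exists_mem_ne_zero_of_ne_bot hD
    obtain ⟨i, hi⟩ := Function.ne_iff.1 hne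
    set f : D →ₗ[K] K := (LinearMap.proj i).comp D.subtype with hf
    have h1 := f.finrank_range_add_finrank_ker
    have h2 : Module.finrank K (LinearMap.range f) ≤ 1 := by
      simpa using (LinearMap.range f).finrank_le
    have h3 : Module.finrank K ((LinearMap.ker f).map D.subtype) =
        Module.finrank K (LinearMap.ker f) :=
      LinearEquiv.finrank_eq (Submodule.equivMapOfInjective _ D.injective_subtype _).symm
    obtain ⟨p, w, hwD, hwp, hwz⟩ := ih ((LinearMap.ker f).map D.subtype) (by omega)
    have hwD' : ∀ j, w j ∈ D ∧ w j i = 0 := fun j => by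
      obtain ⟨a, ha, hae⟩ := hwD j
      rw [← hae]
      exact ⟨a.2, ha⟩
    -- The correction clears `w₀` at the positions `p k`; it leaves position `i` alone because every
    -- `w k` vanishes there.
    refine ⟨Fin.cons i p, Fin.cons (w₀ - ∑ k, (w₀ (p k) / w k (p k)) • w k) w, ?_, ?_, ?_⟩
    · refine Fin.cases ?_ fun j => ?_
      · exact D.sub_mem hw₀ (D.sum_mem fun k _ => D.smul_mem _ (hwD' k).1)
      · exact (hwD' j).1
    · refine Fin.cases ?_ fun j => ?_
      · simpa [Finset.sum_apply, (hwD' _).2] using hi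
      · exact hwp j
    · refine Fin.cases (Fin.cases (fun h => absurd rfl h) fun k _ => ?_) fun j =>
        Fin.cases (fun _ => (hwD' j).2) fun k hjk => hwz j k fun h => hjk (h ▸ rfl)
      simp only [Fin.cons_zero, Fin.cons_succ, Pi.sub_apply, Finset.sum_apply, Pi.smul_apply,
        smul_eq_mul]
      rw [Finset.sum_eq_single k (fun l _ hl => by rw [hwz l k hl, mul_zero]) (by simp),
        div_mul_cancel₀ _ (hwp k), sub_self]

variable {D : Submodule K (ι → K)} {φ : ι → β} {P : Set β → Prop}

/-- If the sets with property `P` are supports of codewords and every nonzero codeword has such a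
set in its support, then every position of a codeword lies in such a set. -/
theorem exists_mem_of_mem_support [Finite ι] (hφ : Function.Injective φ)
    (hP : ∀ X, P X → ∃ w ∈ D, w ≠ 0 ∧ X = φ '' Function.support w)
    (hD : ∀ w ∈ D, w ≠ 0 → ∃ X, P X ∧ X ⊆ φ '' Function.support w)
    (i : ι) (n : ℕ) (w : ι → K) (hw : w ∈ D) (hwi : w i ≠ 0)
    (hn : (Function.support w).ncard ≤ n) :
    ∃ X, P X ∧ φ i ∈ X ∧ X ⊆ φ '' Function.support w := by
  induction n generalizing w with
  | zero =>
    rw [Nat.le_zero, Set.ncard_eq_zero] at hn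
    exact absurd (hn ▸ hwi : i ∈ (∅ : Set ι)) (Set.notMem_empty i)
  | succ n ih =>
    obtain ⟨X, hX, hXw⟩ := hD w hw (fun h => hwi (by rw [h]; rfl))
    obtain ⟨u, hu, hu0, rfl⟩ := hP X hX
    have huw := (Set.image_subset_image_iff hφ).1 hXw
    by_cases hui : u i = 0
    · obtain ⟨k, hk⟩ := Function.ne_iff.1 hu0
      -- Since `u` misses `i`, eliminating position `k` with `u` keeps `i` in the support and makes
      -- the support strictly smaller.
      have hsub : Function.support (w - (w k / u k) • u) ⊂ Function.support w := by
        refine (Set.ssubset_iff_of_subset fun l hl => ?_).2 ⟨k, huw hk, ?_⟩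
        · by_contra hl0
          have h0 : w l = 0 := by simpa using hl0
          have h1 : u l = 0 := by_contra fun h => hl0 (huw h)
          exact hl (by simp [h0, h1])
        · have : u k ≠ 0 := hk
          simp [div_mul_cancel₀ _ this]
      obtain ⟨X, h1, h2, h3⟩ := ih (w - (w k / u k) • u) (D.sub_mem hw (D.smul_mem _ hu))
        (by simpa [hui] using hwi)
        (by have := Set.ncard_lt_ncard hsub; omega)
      exact ⟨X, h1, h2, h3.trans (Set.image_mono hsub.subset)⟩
    · exact ⟨_, hX, ⟨i, hui, rfl⟩, hXw⟩

theorem nonRedundant_iff {r : ℕ} {F : Fin r → Set β} :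
    NonRedundant F ↔ ∀ j, ∃ b ∈ F j, ∀ i, i ≠ j → b ∉ F i := by
  refine forall_congr' fun j => ?_
  have hsub : (⋃ i, ⋃ (_ : i ≠ j), F i) ⊆ ⋃ i, F i :=
    Set.iUnion_mono fun i => Set.iUnion_subset fun _ => subset_rfl
  rw [Set.ssubset_iff_of_subset hsub]
  simp only [Set.mem_iUnion]
  constructor
  · rintro ⟨b, ⟨i, hi⟩, hb⟩
    push Not at hb
    have : i = j := by_contra fun h => hb i h hi
    exact ⟨b, this ▸ hi, hb⟩
  · rintro ⟨b, hb, h⟩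
    exact ⟨b, ⟨j, hb⟩, by push Not; exact h⟩

/-- The generalized Hamming weights of a code in terms of a family of supports of codewords which
contains all the minimal ones. -/
theorem isLeast_unionSizes_ghw [Finite ι] (hφ : Function.Injective φ)
    (hP : ∀ X, P X → ∃ w ∈ D, w ≠ 0 ∧ X = φ '' Function.support w)
    (hD : ∀ w ∈ D, w ≠ 0 → ∃ X, P X ∧ X ⊆ φ '' Function.support w)
    {r : ℕ} (hr : r ≤ Module.finrank K D) :
    IsLeast (unionSizes P r) (ghw D r) := by
  have hmem : ∀ n ∈ unionSizes P r, ∃ D' : Submodule K (ι → K), D' ≤ D ∧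
      Module.finrank K D' = r ∧ (support D').ncard = n := by
    rintro n ⟨F, hF, hred, rfl⟩
    choose w hwD _ hwF using fun i => hP (F i) (hF i)
    refine ⟨Submodule.span K (Set.range w), ?_, ?_, ?_⟩
    · rw [Submodule.span_le]
      rintro _ ⟨j, rfl⟩
      exact hwD j
    · have hli : LinearIndependent K w := by
        rw [Fintype.linearIndependent_iff]
        intro g hg j
        obtain ⟨b, hb, hbj⟩ := nonRedundant_iff.1 hred j
        rw [hwF j] at hb
        obtain ⟨i, hi, rfl⟩ := hb
        have := congr_fun hg i
        rw [Finset.sum_apply, Finset.sum_eq_single j] at this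
        · exact (mul_eq_zero.1 this).resolve_right hi
        · intro k _ hk
          have : w k i = 0 := by
            by_contra h
            exact hbj k hk (by rw [hwF k]; exact ⟨i, h, rfl⟩)
          simp [this]
        · simp
      simpa using finrank_span_eq_card hli
    · rw [support_span_range, ← Set.ncard_image_of_injective _ hφ, Set.image_iUnion]
      congr 1
      exact Set.iUnion_congr fun j => (hwF j).symm
  have hle : ∀ D' : Submodule K (ι → K), D' ≤ D → Module.finrank K D' = r →
      ∃ n ∈ unionSizes P r, n ≤ (support D').ncard := by
    intro D' hD' hr'
    obtain ⟨p, w, hwD, hwp, hwz⟩ := exists_diagonal_family r D' hr'.ge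
    choose F hF hpF hFw using fun j =>
      exists_mem_of_mem_support hφ hP hD (p j) _ (w j) (hD' (hwD j)) (hwp j) le_rfl
    refine ⟨_, ⟨F, hF, ?_, rfl⟩, ?_⟩
    · refine nonRedundant_iff.2 fun j => ⟨φ (p j), hpF j, fun i hij h => ?_⟩
      obtain ⟨l, hl, hlp⟩ := hFw i h
      exact hl (hφ hlp ▸ hwz i j hij)
    · rw [← Set.ncard_image_of_injective (support D') hφ]
      refine Set.ncard_le_ncard (Set.iUnion_subset fun j => (hFw j).trans ?_) (Set.toFinite _)
      exact Set.image_mono fun l hl => ⟨w j, hwD j, hl⟩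
  -- An infimum over the empty set would be 0, so it has to be known that the weight is attained.
  have hne : {n | ∃ D' : Submodule K (ι → K), D' ≤ D ∧ Module.finrank K D' = r ∧
      (support D').ncard = n}.Nonempty := by
    obtain ⟨f, hf⟩ := exists_linearIndependent_of_le_finrank hr
    refine ⟨_, Submodule.span K (Set.range fun j => (f j : ι → K)), ?_, ?_, rfl⟩
    · rw [Submodule.span_le]
      rintro _ ⟨j, rfl⟩
      exact (f j).2
    · have := finrank_span_eq_card (hf.map' D.subtype D.ker_subtype)
      rwa [Fintype.card_fin] at this
  obtain ⟨D', h1, h2, h3⟩ := Nat.sInf_mem hne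
  obtain ⟨n, hn, hnle⟩ := hle D' h1 h2
  have hlow : ∀ n ∈ unionSizes P r, ghw D r ≤ n := fun n hn => Nat.sInf_le (hmem n hn)
  refine ⟨?_, hlow⟩
  have : n = ghw D r := le_antisymm (hnle.trans h3.le) (hlow n hn)
  exact this ▸ hn

end Weights

end IncidenceCode

namespace IncidenceCode

/-! ### Words carried by walks. -/

section Words

variable {α β : Type*} {K : Type*} [Field K] {G : Graph α β}

open Classical in
theorem incidenceMatrix_apply {e : G.edgeSet} {x y : α} (h : G.IsLink e x y) (z : G.vertexSet) :
    incidenceMatrix K G z e = (if z.1 = x then 1 else 0) + (if z.1 = y then 1 else 0) := by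
  have := congr_fun (incidenceMatrix_col K G e ⟨x, h.left_mem⟩ ⟨y, h.right_mem⟩ h) z
  simpa [Pi.single_apply, Subtype.ext_iff] using this

theorem mem_dualCode_incidenceCode [Fintype G.edgeSet] {y : G.edgeSet → K} :
    y ∈ dualCode (incidenceCode K G) ↔ (incidenceMatrix K G).mulVec y = 0 := by
  constructor
  · intro h
    funext x
    exact h _ (Submodule.subset_span (Set.mem_range_self x))
  · intro h x hx
    refine Submodule.span_induction (p := fun x _ => x ⬝ᵥ y = 0) ?_ ?_ ?_ ?_ hx
    · rintro _ ⟨z, rfl⟩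
      exact congr_fun h z
    · simp
    · intro a b _ _ ha hb
      rw [add_dotProduct, ha, hb, add_zero]
    · intro c a _ ha
      rw [smul_dotProduct, ha, smul_zero]

/-- The vertices `v 0, …, v n` and the edges `e 0, …, e (n - 1)` form a walk. -/
def IsWalk (G : Graph α β) (n : ℕ) (v : ℕ → α) (e : ℕ → β) : Prop :=
  ∀ k < n, G.IsLink (e k) (v k) (v (k + 1))

open Classical in
/-- The sum of the edges of a walk with alternating signs. -/
noncomputable def walkWord (K : Type*) [Field K] (G : Graph α β) (n : ℕ) (e : ℕ → β) :
    G.edgeSet → K :=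
  fun b => ∑ k ∈ Finset.range n, if e k = b then (-1) ^ k else 0

open Classical in
-- The contributions `(-1) ^ k` times `v k` plus `v (k + 1)` telescope, so only the two ends
-- survive.
theorem mulVec_walkWord [Fintype G.edgeSet] {n : ℕ} {v : ℕ → α} {e : ℕ → β}
    (h : IsWalk G n v e) (z : G.vertexSet) :
    (incidenceMatrix K G).mulVec (walkWord K G n e) z =
      (if z.1 = v 0 then 1 else 0) - (-1) ^ n * (if z.1 = v n then 1 else 0) := by
  induction n with
  | zero =>
    have : walkWord K G 0 e = 0 := by funext b; simp [walkWord]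
    rw [this, Matrix.mulVec_zero]
    simp
  | succ n ih =>
    have hl := h n n.lt_succ_self
    have hw : walkWord K G (n + 1) e =
        walkWord K G n e + Pi.single (⟨e n, hl.edge_mem⟩ : G.edgeSet) ((-1) ^ n) := by
      funext b
      simp [walkWord, Finset.sum_range_succ, Pi.single_apply, Subtype.ext_iff, eq_comm]
    rw [hw, Matrix.mulVec_add, Pi.add_apply, ih fun k hk => h k (hk.trans n.lt_succ_self),
      Matrix.mulVec_single]
    have := incidenceMatrix_apply (K := K) (e := ⟨e n, hl.edge_mem⟩) hl z
    simp only [Pi.smul_apply, Matrix.col_apply, this, MulOpposite.smul_eq_mul_unop,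
      MulOpposite.unop_op]
    ring

theorem support_walkWord {n : ℕ} {e : ℕ → β} (he : Set.InjOn e (Set.Iio n)) :
    Function.support (walkWord K G n e) = Subtype.val ⁻¹' (e '' Set.Iio n) := by
  ext b
  simp only [Function.mem_support, Set.mem_preimage, Set.mem_image, Set.mem_Iio, walkWord]
  constructor
  · intro h
    obtain ⟨k, hk, hne⟩ := Finset.exists_ne_zero_of_sum_ne_zero h
    exact ⟨k, Finset.mem_range.1 hk, by_contra fun hb => hne (if_neg hb)⟩
  · rintro ⟨k, hk, hb⟩
    rw [Finset.sum_eq_single k, if_pos hb]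
    · simp
    · intro l hl hlk
      exact if_neg fun hlb => hlk (he (Finset.mem_range.1 hl) hk (hlb.trans hb.symm))
    · intro h
      exact absurd (Finset.mem_range.2 hk) h

theorem IsWalk.image_subset {n : ℕ} {v : ℕ → α} {e : ℕ → β} (h : IsWalk G n v e) :
    e '' Set.Iio n ⊆ G.edgeSet := by
  rintro _ ⟨k, hk, rfl⟩
  exact (h k hk).edge_mem

end Words

/-! ### Cycles and simple paths as walks indexed by natural numbers. -/

section Cycles

variable {α β : Type*} {G : Graph α β} {n : ℕ} {v : ℕ → α} {e : ℕ → β}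

/-- The walk `v 0, …, v n = v 0` runs once through a cycle. -/
structure IsClosedPath (G : Graph α β) (n : ℕ) (v : ℕ → α) (e : ℕ → β) : Prop where
  pos : 0 < n
  walk : IsWalk G n v e
  closed : v n = v 0
  inj : Set.InjOn v (Set.Iio n)
  edge_inj : Set.InjOn e (Set.Iio n)

theorem IsClosedPath.isCycleOfLength (h : IsClosedPath G n v e) :
    IsCycleOfLength G n (v '' Set.Iio n) (e '' Set.Iio n) := by
  have : NeZero n := ⟨h.pos.ne'⟩
  refine ⟨this, fun i => v i, fun i => e i, ?_, ?_, ?_, ?_, ?_⟩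
  · exact fun i j hij => Fin.ext (h.inj i.2 j.2 hij)
  · exact fun i j hij => Fin.ext (h.edge_inj i.2 j.2 hij)
  · intro i
    have := h.walk i i.2
    change G.IsLink (e i) (v i) (v (i + 1 : Fin n))
    rw [Fin.val_add, Fin.val_one', Nat.add_mod_mod]
    rcases (Nat.succ_le_of_lt i.2).lt_or_eq with hi | hi
    · rwa [Nat.mod_eq_of_lt hi]
    · have h0 : (i : ℕ) + 1 = n := hi
      rw [h0, Nat.mod_self, ← h.closed]
      rwa [h0] at this
  · ext x
    exact ⟨fun ⟨k, hk, hx⟩ => ⟨⟨k, hk⟩, hx⟩, fun ⟨k, hx⟩ => ⟨k, k.2, hx⟩⟩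
  · ext x
    exact ⟨fun ⟨k, hk, hx⟩ => ⟨⟨k, hk⟩, hx⟩, fun ⟨k, hx⟩ => ⟨k, k.2, hx⟩⟩

/-- Rotating the indices by `j` lets the cycle start at any of its vertices, such as the junction of
a bowtie. -/
theorem IsCycleOfLength.exists_isClosedPath {W : Set α} {X : Set β}
    (h : IsCycleOfLength G n W X) {x : α} (hx : x ∈ W) :
    ∃ v e, IsClosedPath G n v e ∧ v 0 = x ∧ W = v '' Set.Iio n ∧ X = e '' Set.Iio n := by
  obtain ⟨hn, v, e, hv, he, hl, rfl, rfl⟩ := h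
  obtain ⟨j, rfl⟩ := hx
  have hinj : Set.InjOn (fun k => Fin.ofNat n k + j) (Set.Iio n) := by
    intro k hk l hl hkl
    have := congr_arg Fin.val (add_right_cancel hkl)
    simpa [Fin.ofNat, Nat.mod_eq_of_lt hk, Nat.mod_eq_of_lt hl] using this
  have hrange : ∀ i, ∃ k ∈ Set.Iio n, Fin.ofNat n k + j = i := fun i =>
    ⟨(i - j).val, (i - j).2, by
      rw [show Fin.ofNat n (i - j).val = i - j from Fin.ext (Nat.mod_eq_of_lt (i - j).2),
        sub_add_cancel]⟩
  refine ⟨fun k => v (Fin.ofNat n k + j), fun k => e (Fin.ofNat n k + j),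
    ⟨Nat.pos_of_neZero n, fun k _ => ?_, ?_, fun k hk l hl hkl => hinj hk hl (hv hkl),
      fun k hk l hl hkl => hinj hk hl (he hkl)⟩, ?_, ?_, ?_⟩
  · have h1 : Fin.ofNat n (k + 1) + j = Fin.ofNat n k + j + 1 := by
      rw [add_right_comm]
      congr 1
      exact Fin.ext (by simp [Fin.ofNat, Fin.val_add])
    simpa only [h1] using hl (Fin.ofNat n k + j)
  · exact congr_arg (fun i => v (i + j))
      (show Fin.ofNat n n = Fin.ofNat n 0 from Fin.ext (by simp [Fin.ofNat]))
  · simp only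
    rw [show Fin.ofNat n 0 = 0 from Fin.ext (by simp [Fin.ofNat]), zero_add]
  · ext x
    refine ⟨?_, fun ⟨k, _, hx⟩ => ⟨_, hx⟩⟩
    rintro ⟨i, rfl⟩
    obtain ⟨k, hk, rfl⟩ := hrange i
    exact ⟨k, hk, rfl⟩
  · ext x
    refine ⟨?_, fun ⟨k, _, hx⟩ => ⟨_, hx⟩⟩
    rintro ⟨i, rfl⟩
    obtain ⟨k, hk, rfl⟩ := hrange i
    exact ⟨k, hk, rfl⟩

theorem IsCycleOfLength.exists_isClosedPath' {W : Set α} {X : Set β}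
    (h : IsCycleOfLength G n W X) :
    ∃ v e, IsClosedPath G n v e ∧ W = v '' Set.Iio n ∧ X = e '' Set.Iio n := by
  have hx : ∃ x, x ∈ W := by
    obtain ⟨hn, v, e, -, -, -, rfl, -⟩ := h
    exact ⟨v 0, 0, rfl⟩
  obtain ⟨x, hx⟩ := hx
  obtain ⟨v, e, h1, -, h2, h3⟩ := h.exists_isClosedPath hx
  exact ⟨v, e, h1, h2, h3⟩

/-- A closed walk without repeated vertices which does not go back along an edge it has just used
is a cycle. -/
theorem isClosedPath_of_ne (hn : 0 < n) (hw : IsWalk G n v e) (hc : v n = v 0)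
    (hinj : Set.InjOn v (Set.Iio n)) (hne : ∀ k, k + 1 < n → e (k + 1) ≠ e k) :
    IsClosedPath G n v e := by
  refine ⟨hn, hw, hc, hinj, ?_⟩
  have key : ∀ k l, k < l → l < n → e k ≠ e l := by
    intro k l hkl hl h
    have h1 := hw k (hkl.trans hl)
    rw [h] at h1
    rcases h1.eq_and_eq_or_eq_and_eq (hw l hl) with ⟨h2, -⟩ | ⟨h2, h3⟩
    -- An edge repeated in the same direction repeats a vertex; in the opposite direction it forces
    -- `l = k + 1`, an immediate backtrack.
    · exact hkl.ne (hinj (hkl.trans hl) hl h2)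
    · have hkl' : k + 1 = l := hinj (show k + 1 < n by omega) hl h3
      subst hkl'
      exact hne k hl h.symm
  intro k hk l hl hkl
  rcases lt_trichotomy k l with h | h | h
  · exact absurd hkl (key k l h hl)
  · exact h
  · exact absurd hkl.symm (key l k h hk)

theorem isSimplePath_of_injOn (hw : IsWalk G n v e) (hinj : Set.InjOn v (Set.Iic n)) :
    IsSimplePath G (v 0) (v n) (v '' Set.Iic n) (e '' Set.Iio n) := by
  refine ⟨n, fun i => v i, fun i => e i, fun i j hij => Fin.ext
    (hinj (Nat.le_of_lt_succ i.2) (Nat.le_of_lt_succ j.2) hij), fun i => hw i i.2, rfl, rfl, ?_, ?_⟩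
  · ext x
    exact ⟨fun ⟨k, hk, hx⟩ => ⟨⟨k, Nat.lt_succ_of_le hk⟩, hx⟩,
      fun ⟨k, hx⟩ => ⟨k, Nat.le_of_lt_succ k.2, hx⟩⟩
  · ext x
    exact ⟨fun ⟨k, hk, hx⟩ => ⟨⟨k, hk⟩, hx⟩, fun ⟨k, hx⟩ => ⟨k, k.2, hx⟩⟩

theorem IsSimplePath.exists_isWalk [Nonempty β] {x y : α} {W : Set α} {X : Set β}
    (h : IsSimplePath G x y W X) :
    ∃ n v e, IsWalk G n v e ∧ v 0 = x ∧ v n = y ∧ Set.InjOn v (Set.Iic n) ∧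
      W = v '' Set.Iic n ∧ X = e '' Set.Iio n := by
  obtain ⟨n, v, e, hv, hl, rfl, rfl, rfl, rfl⟩ := h
  have hof : ∀ k (hk : k ≤ n), Fin.ofNat (n + 1) k = ⟨k, Nat.lt_succ_of_le hk⟩ := fun k hk =>
    Fin.ext (Nat.mod_eq_of_lt (Nat.lt_succ_of_le hk))
  -- The values past the end of the path are fillers; `β` must be inhabited because the path may
  -- have no edge.
  refine ⟨n, fun k => v (Fin.ofNat (n + 1) k),
    fun k => if h : k < n then e ⟨k, h⟩ else Classical.arbitrary β, ?_, ?_, ?_, ?_, ?_, ?_⟩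
  · intro k hk
    simp only [hk, dif_pos, hof k hk.le, hof (k + 1) hk]
    exact hl ⟨k, hk⟩
  · simp only [hof 0 (Nat.zero_le n)]
    rfl
  · simp only [hof n le_rfl]
    rfl
  · intro k hk l hl hkl
    simp only [hof k hk, hof l hl] at hkl
    exact congr_arg Fin.val (hv hkl)
  · ext x
    refine ⟨?_, fun ⟨k, _, hx⟩ => ⟨_, hx⟩⟩
    rintro ⟨i, rfl⟩
    exact ⟨i, Nat.le_of_lt_succ i.2, by simp only [hof i (Nat.le_of_lt_succ i.2)]⟩
  · ext x
    constructor
    · rintro ⟨i, rfl⟩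
      exact ⟨i, i.2, by simp⟩
    · rintro ⟨k, hk, rfl⟩
      exact ⟨⟨k, hk⟩, by simp only [Set.mem_Iio.1 hk, dif_pos]⟩

theorem injOn_edges_of_injOn (hw : IsWalk G n v e) (hinj : Set.InjOn v (Set.Iic n)) :
    Set.InjOn e (Set.Iio n) := by
  have key : ∀ k l, k < l → l < n → e k ≠ e l := by
    intro k l hkl hl h
    have h1 := hw k (hkl.trans hl)
    rw [h] at h1
    rcases h1.left_eq_or_eq (hw l hl) with h2 | h2
    · exact hkl.ne (hinj (hkl.trans hl).le hl.le h2)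
    · exact (hkl.trans l.lt_succ_self).ne (hinj (hkl.trans hl).le hl h2)
  intro k hk l hl hkl
  rcases lt_trichotomy k l with h | h | h
  · exact absurd hkl (key k l h hl)
  · exact h
  · exact absurd hkl.symm (key l k h hk)

end Cycles

end IncidenceCode

namespace IncidenceCode

/-! ### Finding cycles and bowties by walking without backtracking. -/

section Search

variable {α β : Type*} {G : Graph α β} {H : Set β}

/-- If no edge of `H` ends at a vertex where it is the only edge of `H`, then a walk in `H` can be
continued forever without using the same edge twice in a row. -/
theorem exists_nonbacktracking_walk
    (hH : ∀ f ∈ H, ∀ x, G.Inc f x → ∃ f' ∈ H, f' ≠ f ∧ G.Inc f' x)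
    {f : β} (hf : f ∈ H) {x y : α} (hxy : G.IsLink f x y) :
    ∃ (v : ℕ → α) (e : ℕ → β), v 0 = x ∧ e 0 = f ∧ (∀ k, G.IsLink (e k) (v k) (v (k + 1))) ∧
      (∀ k, e k ∈ H) ∧ ∀ k, e (k + 1) ≠ e k := by
  -- A state is an edge of `H` with a direction; its successor leaves the head by a different edge.
  have step : ∀ d : {d : β × α × α // d.1 ∈ H ∧ G.IsLink d.1 d.2.1 d.2.2},
      ∃ d' : {d : β × α × α // d.1 ∈ H ∧ G.IsLink d.1 d.2.1 d.2.2},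
        d'.1.1 ≠ d.1.1 ∧ d'.1.2.1 = d.1.2.2 := by
    rintro ⟨⟨f, x, y⟩, hf, hl⟩
    obtain ⟨f', hf', hne, z, hz⟩ := hH f hf y hl.inc_right
    exact ⟨⟨⟨f', y, z⟩, hf', hz⟩, hne, rfl⟩
  choose next hne hnext using step
  let d : ℕ → {d : β × α × α // d.1 ∈ H ∧ G.IsLink d.1 d.2.1 d.2.2} :=
    fun k => Nat.rec ⟨⟨f, x, y⟩, hf, hxy⟩ (fun _ d => next d) k
  refine ⟨fun k => (d k).1.2.1, fun k => (d k).1.1, rfl, rfl, fun k => ?_, fun k => (d k).2.1,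
    fun k => hne (d k)⟩
  have h1 : (d (k + 1)).1.2.1 = (d k).1.2.2 := hnext (d k)
  simp only [h1]
  exact (d k).2.2

/-- The first time at which a sequence of vertices enters `W` or repeats a vertex. -/
theorem exists_first_return [Finite G.vertexSet] {v : ℕ → α} (hv : ∀ k, v k ∈ G.vertexSet)
    (W : Set α) :
    ∃ j, 0 < j ∧ (v j ∈ W ∨ ∃ i < j, v j = v i) ∧ (∀ k, 0 < k → k < j → v k ∉ W) ∧
      Set.InjOn v (Set.Iio j) := by
  classical
  have hex : ∃ j, 0 < j ∧ (v j ∈ W ∨ ∃ i < j, v j = v i) := by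
    obtain ⟨k, l, hkl, h⟩ := Finite.exists_ne_map_eq_of_infinite
      (fun k => (⟨v k, hv k⟩ : G.vertexSet))
    have h' : v k = v l := congr_arg Subtype.val h
    rcases lt_or_gt_of_ne hkl with hlt | hlt
    · exact ⟨l, by omega, Or.inr ⟨k, hlt, h'.symm⟩⟩
    · exact ⟨k, by omega, Or.inr ⟨l, hlt, h'⟩⟩
  refine ⟨Nat.find hex, (Nat.find_spec hex).1, (Nat.find_spec hex).2, fun k h0 hk hW =>
    Nat.find_min hex hk ⟨h0, Or.inl hW⟩, ?_⟩
  have key : ∀ k l, k < l → l < Nat.find hex → v k ≠ v l := fun k l hkl hl h =>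
    Nat.find_min hex hl ⟨by omega, Or.inr ⟨k, hkl, h.symm⟩⟩
  intro k hk l hl hkl
  rcases lt_trichotomy k l with h | h | h
  · exact absurd hkl (key k l h hl)
  · exact h
  · exact absurd hkl.symm (key l k h hk)

theorem isClosedPath_segment {v : ℕ → α} {e : ℕ → β}
    (hl : ∀ k, G.IsLink (e k) (v k) (v (k + 1))) (hne : ∀ k, e (k + 1) ≠ e k) {i j : ℕ}
    (hij : i < j) (hji : v j = v i) (hinj : Set.InjOn v (Set.Iio j)) :
    IsClosedPath G (j - i) (fun k => v (i + k)) (fun k => e (i + k)) := by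
  refine isClosedPath_of_ne (by omega) (fun k _ => hl (i + k)) ?_ ?_ fun k _ => hne (i + k)
  · simp only [Nat.add_sub_cancel' hij.le, hji, add_zero]
  · intro k hk l hl' hkl
    rw [Set.mem_Iio] at hk hl'
    have := hinj (show i + k < j by omega) (show i + l < j by omega) hkl
    omega

theorem exists_isClosedPath [Finite G.vertexSet]
    (hH : ∀ f ∈ H, ∀ x, G.Inc f x → ∃ f' ∈ H, f' ≠ f ∧ G.Inc f' x)
    (hHG : H ⊆ G.edgeSet) (hne : H.Nonempty) :
    ∃ n v e, IsClosedPath G n v e ∧ e '' Set.Iio n ⊆ H := by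
  obtain ⟨f, hf⟩ := hne
  obtain ⟨x, y, hxy⟩ := G.exists_isLink_of_mem_edgeSet (hHG hf)
  obtain ⟨v, e, -, -, hl, heH, hb⟩ := exists_nonbacktracking_walk hH hf hxy
  obtain ⟨j, -, h | ⟨i, hij, hji⟩, -, hinj⟩ :=
    exists_first_return (fun k => (hl k).left_mem) (∅ : Set α)
  · exact absurd h (Set.notMem_empty _)
  · refine ⟨_, _, _, isClosedPath_segment hl hb hij hji hinj, ?_⟩
    rintro _ ⟨k, -, rfl⟩
    exact heH _

theorem IsClosedPath.mem_of_isLink {n : ℕ} {v : ℕ → α} {e : ℕ → β} (h : IsClosedPath G n v e)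
    {k : ℕ} (hk : k < n) {x y : α} (hl : G.IsLink (e k) x y) : x ∈ v '' Set.Iio n := by
  rcases hl.left_eq_or_eq (h.walk k hk) with rfl | rfl
  · exact ⟨k, hk, rfl⟩
  · rcases (Nat.succ_le_of_lt hk).lt_or_eq with h1 | h1
    · exact ⟨k + 1, h1, rfl⟩
    · exact ⟨0, h.pos, by rw [← h.closed, ← h1]⟩

/-- Two paths with the same ends and nothing else in common form a cycle. -/
theorem isClosedPath_of_two_paths {a j : ℕ} {c v : ℕ → α} {d e : ℕ → β}
    (hc : IsWalk G a c d) (hv : IsWalk G j v e) (hci : Set.InjOn c (Set.Iic a))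
    (hvi : Set.InjOn v (Set.Iic j)) (h0 : c 0 = v 0) (h1 : c a = v j) (ha : 0 < a)
    (hint : ∀ k, 0 < k → k < j → v k ∉ c '' Set.Iic a)
    (hde : ∀ k < a, ∀ l < j, d k ≠ e l) :
    IsClosedPath G (a + j) (fun k => if k ≤ a then c k else v (a + j - k))
      (fun k => if k < a then d k else e (a + j - 1 - k)) := by
  have hdi := injOn_edges_of_injOn hc hci
  have hei := injOn_edges_of_injOn hv hvi
  -- After index `a` the walk follows `v` backwards, which accounts for the reversed indices.
  refine ⟨by omega, fun k hk => ?_, ?_, fun k hk l hl hkl => ?_, fun k hk l hl hkl => ?_⟩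
  · rcases lt_trichotomy (k + 1) (a + 1) with h | h | h
    · simp only [show k < a by omega, show k ≤ a by omega, show k + 1 ≤ a by omega, if_true]
      exact hc k (by omega)
    · obtain rfl : k = a := by omega
      simp only [lt_irrefl, if_false, le_refl, if_true, show ¬ k + 1 ≤ k by omega, h1]
      have := (hv (k + j - 1 - k) (by omega)).symm
      rw [show k + j - 1 - k + 1 = j by omega] at this
      rwa [show k + j - (k + 1) = k + j - 1 - k by omega]
    · simp only [show ¬ k < a by omega, show ¬ k ≤ a by omega, show ¬ k + 1 ≤ a by omega,
        if_false]
      have := (hv (a + j - 1 - k) (by omega)).symm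
      rw [show a + j - 1 - k + 1 = a + j - k by omega] at this
      rwa [show a + j - (k + 1) = a + j - 1 - k by omega]
  · simp only [Nat.zero_le, if_true]
    split_ifs with h
    · obtain rfl : j = 0 := by omega
      rw [add_zero, h1, h0]
    · rw [Nat.sub_self, h0]
  · rw [Set.mem_Iio] at hk hl
    split_ifs at hkl with hk' hl' hl'
    · exact hci hk' hl' hkl
    · exact absurd ⟨k, hk', hkl⟩ (hint (a + j - l) (by omega) (by omega))
    · exact absurd ⟨l, hl', hkl.symm⟩ (hint (a + j - k) (by omega) (by omega))
    · have := hvi (show a + j - k ≤ j by omega) (show a + j - l ≤ j by omega) hkl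
      omega
  · rw [Set.mem_Iio] at hk hl
    split_ifs at hkl with hk' hl' hl'
    · exact hdi hk' hl' hkl
    · exact absurd hkl (hde k hk' _ (by omega))
    · exact absurd hkl.symm (hde l hl' _ (by omega))
    · have := hei (show a + j - 1 - k < j by omega) (show a + j - 1 - l < j by omega) hkl
      omega

/-- An odd cycle and a path which meets it exactly in its two distinct ends contain an even
cycle. -/
theorem IsClosedPath.exists_even_of_ear {n j : ℕ} {c v : ℕ → α} {d e : ℕ → β}
    (hc : IsClosedPath G n c d) (hn : Odd n) (hv : IsWalk G j v e)
    (hvi : Set.InjOn v (Set.Iic j)) (h0 : c 0 = v 0) (h1 : v j ∈ c '' Set.Iio n)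
    (hne : v j ≠ v 0) (hint : ∀ k, 0 < k → k < j → v k ∉ c '' Set.Iio n)
    (hde : ∀ k < n, ∀ l < j, d k ≠ e l) :
    ∃ X ⊆ d '' Set.Iio n ∪ e '' Set.Iio j, IsEvenCycle G X := by
  obtain ⟨a, ha, hav⟩ := h1
  rw [Set.mem_Iio] at ha
  have ha0 : 0 < a := Nat.pos_of_ne_zero fun h => hne (by rw [← hav, h, h0])
  -- The ends of the ear cut the odd cycle into arcs of lengths `a` and `n - a`, of different
  -- parity, so exactly one arc closes the ear to an even cycle.
  rcases Nat.even_or_odd (a + j) with heven | hodd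
  · have := isClosedPath_of_two_paths (fun k hk => hc.walk k (hk.trans ha)) hv
      (hc.inj.mono fun k hk => lt_of_le_of_lt hk ha) hvi h0 hav ha0
      (fun k hk hkj h => hint k hk hkj (Set.image_mono (fun k hk => lt_of_le_of_lt hk ha) h))
      (fun k hk => hde k (hk.trans ha))
    refine ⟨_, ?_, _, _, heven, this.isCycleOfLength⟩
    rintro _ ⟨k, hk, rfl⟩
    rw [Set.mem_Iio] at hk
    simp only
    split_ifs with h
    · exact Or.inl ⟨k, h.trans ha, rfl⟩
    · exact Or.inr ⟨_, show a + j - 1 - k < j by omega, rfl⟩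
  · have hmem : ∀ k ≤ n - a, c (n - k) ∈ c '' Set.Iio n := fun k hk => by
      rcases Nat.eq_zero_or_pos k with rfl | h
      · exact ⟨0, hc.pos, hc.closed.symm⟩
      · exact ⟨n - k, show n - k < n by omega, rfl⟩
    have := isClosedPath_of_two_paths (a := n - a) (c := fun k => c (n - k))
      (d := fun k => d (n - 1 - k)) (G := G) (v := v) (e := e) (j := j)
      (fun k hk => ?_) hv (fun k hk l hl hkl => ?_) hvi
      (by simpa only [Nat.sub_zero, hc.closed] using h0)
      (by simpa only [Nat.sub_sub_self ha.le] using hav) (by omega)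
      (fun k hk hkj h => ?_) (fun k hk => hde _ (by omega))
    · refine ⟨_, ?_, _, _, ?_, this.isCycleOfLength⟩
      · rintro _ ⟨k, hk, rfl⟩
        rw [Set.mem_Iio] at hk
        simp only
        split_ifs with h
        · exact Or.inl ⟨_, show n - 1 - k < n by omega, rfl⟩
        · exact Or.inr ⟨_, show n - a + j - 1 - k < j by omega, rfl⟩
      · have h2 : Even (n + (a + j)) := hn.add_odd hodd
        rw [Nat.even_iff] at h2 ⊢
        omega
    · have := (hc.walk (n - 1 - k) (by omega)).symm
      rw [show n - 1 - k + 1 = n - k by omega] at this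
      change G.IsLink (d (n - 1 - k)) (c (n - k)) (c (n - (k + 1)))
      rwa [show n - (k + 1) = n - 1 - k by omega]
    · rw [Set.mem_Iic] at hk hl
      simp only at hkl
      -- The second arc starts at index `n`, just outside the range where `c` is injective; `c n = c
      -- 0` covers this end.
      have hzero : ∀ m, 0 < m → m ≤ n - a → c (n - m) ≠ c (n - 0) := fun m hm hma h => by
        rw [Nat.sub_zero, hc.closed] at h
        have := hc.inj (show n - m < n by omega) hc.pos h
        omega
      rcases Nat.eq_zero_or_pos k with rfl | hk0 <;> rcases Nat.eq_zero_or_pos l with rfl | hl0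
      · rfl
      · exact absurd hkl.symm (hzero l hl0 hl)
      · exact absurd hkl (hzero k hk0 hk)
      · have := hc.inj (show n - k < n by omega) (show n - l < n by omega) hkl
        omega
    · obtain ⟨l, hl, hlk⟩ := h
      exact hint k hk hkj (hlk ▸ hmem l hl)

/-- If no edge of `H` ends at a vertex where it is the only edge of `H` and no odd cycle is a
connected component of `H`, then `H` contains an even cycle or a bowtie. -/
theorem exists_isEvenCycle_or_isBowtie [Finite G.vertexSet]
    (hH : ∀ f ∈ H, ∀ x, G.Inc f x → ∃ f' ∈ H, f' ≠ f ∧ G.Inc f' x)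
    (hHG : H ⊆ G.edgeSet) (hne : H.Nonempty)
    (hodd : ∀ n v e, IsClosedPath G n v e → Odd n → e '' Set.Iio n ⊆ H →
      ∃ f ∈ H, f ∉ e '' Set.Iio n ∧ ∃ x ∈ v '' Set.Iio n, G.Inc f x) :
    ∃ X ⊆ H, IsEvenCycle G X ∨ IsBowtie G X := by
  obtain ⟨n, c', d', hcd, hdH⟩ := exists_isClosedPath hH hHG hne
  rcases Nat.even_or_odd n with hn | hn
  · exact ⟨_, hdH, Or.inl ⟨_, _, hn, hcd.isCycleOfLength⟩⟩
  obtain ⟨f, hf, hfd, x, hx, y, hxy⟩ := hodd n c' d' hcd hn hdH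
  obtain ⟨c, d, hc, rfl, hcc, hdd⟩ := hcd.isCycleOfLength.exists_isClosedPath hx
  rw [hdd] at hdH hfd
  clear hx hcd hcc hdd
  obtain ⟨v, e, hv0, he0, hl, heH, hb⟩ := exists_nonbacktracking_walk hH hf hxy
  obtain ⟨j, hj, hret, hvW, hinj⟩ :=
    exists_first_return (fun k => (hl k).left_mem) (c '' Set.Iio n)
  have heC : ∀ k < n, ∀ l < j, d k ≠ e l := by
    intro k hk l hlj h
    rcases Nat.eq_zero_or_pos l with rfl | hl0
    · exact hfd ⟨k, hk, by rw [h, he0]⟩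
    · exact hvW l hl0 hlj (hc.mem_of_isLink hk (h ▸ hl l))
  have heH' : ∀ i, e '' Set.Iio i ⊆ H := by
    rintro i _ ⟨k, -, rfl⟩
    exact heH k
  have hc0 : c 0 ∈ c '' Set.Iio n := ⟨0, hc.pos, rfl⟩
  -- Back at `c 0`, the walk is a second cycle sharing one vertex with the first; at another vertex
  -- of the cycle it is an ear; if it meets itself first, it is a path followed by a cycle disjoint
  -- from the first.
  by_cases hjW : v j ∈ c '' Set.Iio n
  · by_cases hj0 : v j = v 0
    · have h2 := isClosedPath_segment hl hb hj hj0 hinj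
      simp only [Nat.sub_zero, zero_add] at h2
      rcases Nat.even_or_odd j with hje | hjo
      · exact ⟨_, heH' j, Or.inl ⟨_, _, hje, h2.isCycleOfLength⟩⟩
      · refine ⟨_, Set.union_subset hdH (heH' j), Or.inr ⟨_, _, _, _,
          ⟨n, hn, hc.isCycleOfLength⟩, ⟨j, hjo, h2.isCycleOfLength⟩, Or.inl ⟨⟨c 0, ?_⟩, ?_, rfl⟩⟩⟩
        · refine Set.eq_singleton_iff_unique_mem.2 ⟨⟨hc0, 0, hj, hv0⟩, ?_⟩
          rintro _ ⟨hW, k, hk, rfl⟩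
          rcases Nat.eq_zero_or_pos k with rfl | hk0
          · exact hv0
          · exact absurd hW (hvW k hk0 hk)
        · rw [Set.disjoint_left]
          rintro _ ⟨k, hk, rfl⟩ ⟨l, hl', h⟩
          exact heC k hk l hl' h.symm
    · have hinj' : Set.InjOn v (Set.Iic j) := by
        have hvj : ∀ k < j, v k ≠ v j := by
          intro k hk h
          rcases Nat.eq_zero_or_pos k with rfl | hk0
          · exact hj0 h.symm
          · exact hvW k hk0 hk (h ▸ hjW)
        intro k hk l hl' hkl
        rcases (Set.mem_Iic.1 hk).lt_or_eq with h1 | rfl <;>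
          rcases (Set.mem_Iic.1 hl').lt_or_eq with h2 | rfl
        · exact hinj h1 h2 hkl
        · exact absurd hkl (hvj k h1)
        · exact absurd hkl.symm (hvj l h2)
        · rfl
      obtain ⟨X, hX, hXe⟩ := hc.exists_even_of_ear hn (fun k _ => hl k) hinj' hv0.symm hjW hj0
        hvW heC
      exact ⟨X, hX.trans (Set.union_subset hdH (heH' j)), Or.inl hXe⟩
  · obtain ⟨i, hij, hji⟩ := hret.resolve_left hjW
    have hi0 : 0 < i := Nat.pos_of_ne_zero fun h => hjW (by rw [hji, h, hv0]; exact hc0)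
    have h2 := isClosedPath_segment hl hb hij hji hinj
    have h2H : (fun k => e (i + k)) '' Set.Iio (j - i) ⊆ H := by
      rintro _ ⟨k, -, rfl⟩
      exact heH _
    rcases Nat.even_or_odd (j - i) with hje | hjo
    · exact ⟨_, h2H, Or.inl ⟨_, _, hje, h2.isCycleOfLength⟩⟩
    · have hinj' : Set.InjOn v (Set.Iic i) := hinj.mono fun k hk => lt_of_le_of_lt hk hij
      refine ⟨_, Set.union_subset (Set.union_subset hdH h2H) (heH' i), Or.inr ⟨_, _, _, _,
        ⟨n, hn, hc.isCycleOfLength⟩, ⟨j - i, hjo, h2.isCycleOfLength⟩, Or.inr ⟨?_, _, _, _, _,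
          isSimplePath_of_injOn (fun k _ => hl k) hinj', ?_, ?_, rfl⟩⟩⟩
      · rw [Set.disjoint_left]
        rintro _ hW ⟨k, hk, rfl⟩
        rw [Set.mem_Iio] at hk
        exact hvW (i + k) (by omega) (by omega) hW
      · refine Set.eq_singleton_iff_unique_mem.2 ⟨⟨⟨0, hi0.le, rfl⟩, hv0 ▸ hc0⟩, ?_⟩
        rintro _ ⟨⟨k, hk, rfl⟩, hW⟩
        rw [Set.mem_Iic] at hk
        rcases Nat.eq_zero_or_pos k with rfl | hk0
        · rfl
        · exact absurd hW (hvW k hk0 (by omega))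
      · refine Set.eq_singleton_iff_unique_mem.2
          ⟨⟨⟨i, le_refl i, rfl⟩, 0, show 0 < j - i by omega, rfl⟩, ?_⟩
        rintro _ ⟨⟨k, hk, rfl⟩, l, hl', h⟩
        rw [Set.mem_Iic] at hk
        rw [Set.mem_Iio] at hl'
        have := hinj (show i + l < j by omega) (show k < j by omega) h
        rw [show k = i by omega]

end Search

end IncidenceCode

namespace IncidenceCode

/-! ### Supports of words of the dual code, and its dimension. -/

section DualCode

variable {α β : Type*} {K : Type*} [Field K] {G : Graph α β}

theorem image_support_walkWord {n : ℕ} {v : ℕ → α} {e : ℕ → β} (h : IsWalk G n v e)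
    (he : Set.InjOn e (Set.Iio n)) :
    Subtype.val '' Function.support (walkWord K G n e) = e '' Set.Iio n := by
  rw [support_walkWord he, Subtype.image_preimage_coe]
  exact Set.inter_eq_right.2 h.image_subset

theorem incidenceMatrix_eq_zero {f : G.edgeSet} {x : G.vertexSet} (h : ¬ G.Inc f x) :
    incidenceMatrix K G x f = 0 := by
  obtain ⟨y, z, hl⟩ := G.exists_isLink_of_mem_edgeSet f.2
  rw [incidenceMatrix_apply hl, if_neg, if_neg, add_zero]
  · rintro rfl
    exact h hl.inc_right
  · rintro rfl
    exact h hl.inc_left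

open Classical in
theorem vecMul_incidenceMatrix [Fintype G.vertexSet] (τ : G.vertexSet → K) {b : G.edgeSet}
    {x y : G.vertexSet} (h : G.IsLink b x y) :
    Matrix.vecMul τ (incidenceMatrix K G) b = τ x + τ y := by
  have : Matrix.vecMul τ (incidenceMatrix K G) b = τ ⬝ᵥ fun z => incidenceMatrix K G z b := rfl
  rw [this, incidenceMatrix_col K G b x y h, dotProduct_add]
  simp

/-- Otherwise the parity check at `x` would consist of a single nonzero term. -/
theorem exists_ne_of_mem_dualCode [Fintype G.edgeSet] {w : G.edgeSet → K}
    (hw : w ∈ dualCode (incidenceCode K G)) {f : G.edgeSet} (hf : w f ≠ 0) {x : G.vertexSet}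
    (hM : incidenceMatrix K G x f ≠ 0) :
    ∃ f' ∈ Subtype.val '' Function.support w, f' ≠ f ∧ G.Inc f' x := by
  by_contra! h
  have h0 := congr_fun (mem_dualCode_incidenceCode.1 hw) x
  rw [Matrix.mulVec, dotProduct, Finset.sum_eq_single f] at h0
  · exact (mul_ne_zero hM hf) h0
  · intro b _ hb
    by_cases hwb : w b = 0
    · rw [hwb, mul_zero]
    · rw [incidenceMatrix_eq_zero (h b ⟨b, hwb, rfl⟩ fun h => hb (Subtype.ext h)), zero_mul]
  · simp

theorem image_support_nonempty {w : G.edgeSet → K} (hw : w ≠ 0) :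
    (Subtype.val '' Function.support w).Nonempty :=
  (Function.support_nonempty_iff.2 hw).image _

theorem ne_zero_of_image_support {w : G.edgeSet → K} {X : Set β} (hX : X.Nonempty)
    (h : X = Subtype.val '' Function.support w) : w ≠ 0 := by
  rintro rfl
  simp [h] at hX

theorem IsClosedPath.nonempty {n : ℕ} {v : ℕ → α} {e : ℕ → β} (h : IsClosedPath G n v e) :
    (e '' Set.Iio n).Nonempty := ⟨e 0, 0, h.pos, rfl⟩

theorem walkWord_mem_dualCode [Fintype G.edgeSet] {n : ℕ} {v : ℕ → α} {e : ℕ → β}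
    (h : IsClosedPath G n v e) (hn : (-1 : K) ^ n = 1) :
    walkWord K G n e ∈ dualCode (incidenceCode K G) := by
  classical
  rw [mem_dualCode_incidenceCode]
  funext z
  rw [mulVec_walkWord h.walk, h.closed, hn, one_mul, sub_self, Pi.zero_apply]

theorem exists_mem_dualCode_of_isClosedPath [Fintype G.edgeSet] {n : ℕ} {v : ℕ → α} {e : ℕ → β}
    (h : IsClosedPath G n v e) (hn : (-1 : K) ^ n = 1) :
    ∃ w ∈ dualCode (incidenceCode K G), w ≠ 0 ∧
      e '' Set.Iio n = Subtype.val '' Function.support w :=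
  have hs := (image_support_walkWord (K := K) h.walk h.edge_inj).symm
  ⟨_, walkWord_mem_dualCode h hn, ne_zero_of_image_support h.nonempty hs, hs⟩

section Signed

variable {σ : α → K}

/-- The value of `σ` changes sign at each step and must return to itself. -/
theorem neg_one_pow_eq_one_of_isClosedPath (hσ0 : ∀ x, σ x ≠ 0)
    (hσ : ∀ e x y, G.IsLink e x y → σ x + σ y = 0) {n : ℕ} {v : ℕ → α} {e : ℕ → β}
    (h : IsClosedPath G n v e) : (-1 : K) ^ n = 1 := by
  have key : ∀ k ≤ n, σ (v k) = (-1) ^ k * σ (v 0) := by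
    intro k
    induction k with
    | zero => simp
    | succ k ih =>
      intro hk
      have h1 := hσ _ _ _ (h.walk k hk)
      rw [ih (Nat.le_of_succ_le hk)] at h1
      linear_combination h1
  have := key n le_rfl
  rw [h.closed] at this
  exact mul_right_cancel₀ (hσ0 (v 0)) (by rw [← this, one_mul])

theorem exists_mem_dualCode_of_isCycle [Fintype G.edgeSet] (hσ0 : ∀ x, σ x ≠ 0)
    (hσ : ∀ e x y, G.IsLink e x y → σ x + σ y = 0) {X : Set β} (hX : IsCycle G X) :
    ∃ w ∈ dualCode (incidenceCode K G), w ≠ 0 ∧ X = Subtype.val '' Function.support w := by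
  obtain ⟨n, W, hX⟩ := hX
  obtain ⟨v, e, h, -, rfl⟩ := hX.exists_isClosedPath'
  exact exists_mem_dualCode_of_isClosedPath h (neg_one_pow_eq_one_of_isClosedPath hσ0 hσ h)

theorem exists_isCycle_of_mem_dualCode [Fintype G.vertexSet] [Fintype G.edgeSet]
    {w : G.edgeSet → K} (hw : w ∈ dualCode (incidenceCode K G)) (hw0 : w ≠ 0) :
    ∃ X, IsCycle G X ∧ X ⊆ Subtype.val '' Function.support w := by
  classical
  -- In characteristic 2 the column of a loop is zero, so a loop may be a dead end of the support;
  -- but it is already a cycle.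
  by_cases hloop : ∃ f ∈ Subtype.val '' Function.support w, ∃ x, G.IsLink f x x
  · obtain ⟨f, hf, x, hx⟩ := hloop
    have h : IsClosedPath G 1 (fun _ => x) (fun _ => f) :=
      ⟨one_pos, fun _ _ => hx, rfl, fun k hk l hl _ => by
        rw [Set.mem_Iio] at hk hl; omega, fun k hk l hl _ => by
        rw [Set.mem_Iio] at hk hl; omega⟩
    refine ⟨_, ⟨_, _, h.isCycleOfLength⟩, ?_⟩
    rintro _ ⟨k, -, rfl⟩
    exact hf
  · push Not at hloop
    have hedge : ∀ f ∈ Subtype.val '' Function.support w, ∀ x, G.Inc f x →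
        ∃ f' ∈ Subtype.val '' Function.support w, f' ≠ f ∧ G.Inc f' x := by
      rintro _ ⟨f, hf, rfl⟩ x ⟨y, hxy⟩
      refine exists_ne_of_mem_dualCode hw hf (x := ⟨x, hxy.left_mem⟩) ?_
      rw [incidenceMatrix_apply hxy, if_pos rfl, if_neg, add_zero]
      · exact one_ne_zero
      · rintro h
        change x = y at h
        exact hloop f ⟨f, hf, rfl⟩ x (by rwa [← h] at hxy)
    obtain ⟨n, v, e, h, hH⟩ := exists_isClosedPath hedge (Subtype.coe_image_subset _ _)
      (image_support_nonempty hw0)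
    exact ⟨_, ⟨_, _, h.isCycleOfLength⟩, hH⟩

end Signed

section Odd

/-- The alternating sum of the vertices of a closed walk. -/
theorem sum_alternating {n : ℕ} {v : ℕ → α} {e : ℕ → β} [DecidableEq α]
    (h : IsClosedPath G n v e) {l : ℕ} (hl : l < n) :
    (∑ k ∈ Finset.range n, if v k = v l then (-1 : K) ^ k else 0) = (-1) ^ l := by
  rw [Finset.sum_eq_single l, if_pos rfl]
  · intro k hk hkl
    exact if_neg fun hv => hkl (h.inj (Finset.mem_range.1 hk) hl hv)
  · intro hl'
    exact absurd (Finset.mem_range.2 hl) hl'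

/-- If 2 is invertible, no odd cycle is a connected component of the support of a word of the dual
code. -/
theorem exists_edge_off_odd_cycle [Fintype G.vertexSet] [Fintype G.edgeSet] (h2 : (2 : K) ≠ 0)
    {w : G.edgeSet → K} (hw : w ∈ dualCode (incidenceCode K G)) {n : ℕ} {v : ℕ → α} {e : ℕ → β}
    (h : IsClosedPath G n v e) (hn : Odd n)
    (hH : e '' Set.Iio n ⊆ Subtype.val '' Function.support w) :
    ∃ f ∈ Subtype.val '' Function.support w, f ∉ e '' Set.Iio n ∧
      ∃ x ∈ v '' Set.Iio n, G.Inc f x := by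
  classical
  by_contra! hcon
  -- Alternating signs around the cycle cancel on each of its edges except the closing one `b₀`,
  -- where oddness gives `1 + 1`. If no other edge of the support met the cycle, pairing `τ` with
  -- the parity checks would give `2 * w b₀ = 0`.
  set τ : G.vertexSet → K := fun z => ∑ k ∈ Finset.range n, if v k = z then (-1) ^ k else 0 with hτ
  have hn1 : n - 1 < n := Nat.sub_lt h.pos one_pos
  obtain ⟨b₀, hb₀, hbe⟩ := hH ⟨n - 1, hn1, rfl⟩
  have hpair : τ ⬝ᵥ (incidenceMatrix K G).mulVec w = 0 := by
    rw [mem_dualCode_incidenceCode.1 hw, dotProduct_zero]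
  rw [Matrix.dotProduct_mulVec, dotProduct, Finset.sum_eq_single b₀] at hpair
  · have hl := h.walk _ hn1
    rw [← hbe, Nat.sub_add_cancel h.pos, h.closed] at hl
    rw [vecMul_incidenceMatrix τ (x := ⟨v (n - 1), hl.left_mem⟩) (y := ⟨v 0, hl.right_mem⟩) hl,
      hτ] at hpair
    simp only [sum_alternating h hn1, sum_alternating h h.pos] at hpair
    rw [(Nat.Odd.sub_odd hn odd_one).neg_one_pow, pow_zero, one_add_one_eq_two] at hpair
    exact (mul_ne_zero h2 hb₀) hpair
  · intro b _ hb
    by_cases hwb : w b = 0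
    · rw [hwb, mul_zero]
    suffices Matrix.vecMul τ (incidenceMatrix K G) b = 0 by rw [this, zero_mul]
    by_cases hbC : b.1 ∈ e '' Set.Iio n
    · obtain ⟨l, hl, hlb⟩ := hbC
      rw [Set.mem_Iio] at hl
      have hl1 : l + 1 < n := by
        refine lt_of_le_of_ne hl fun h1 => hb (Subtype.ext ?_)
        rw [← hlb, hbe, show l = n - 1 by omega]
      have hlk := h.walk l hl
      rw [hlb] at hlk
      rw [vecMul_incidenceMatrix τ (x := ⟨v l, hlk.left_mem⟩) (y := ⟨v (l + 1), hlk.right_mem⟩)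
        hlk, hτ]
      simp only [sum_alternating h hl, sum_alternating h hl1]
      ring
    · obtain ⟨x, y, hxy⟩ := G.exists_isLink_of_mem_edgeSet b.2
      have h0 : ∀ z : G.vertexSet, G.Inc b z → τ z = 0 := fun z hz =>
        Finset.sum_eq_zero fun k hk => if_neg fun hkz =>
          hcon b ⟨b, hwb, rfl⟩ hbC z ⟨k, Finset.mem_range.1 hk, hkz⟩ hz
      rw [vecMul_incidenceMatrix τ (x := ⟨x, hxy.left_mem⟩) (y := ⟨y, hxy.right_mem⟩) hxy,
        h0 _ hxy.inc_left, h0 _ hxy.inc_right, add_zero]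
  · simp

theorem exists_isEvenCycle_or_isBowtie_of_mem_dualCode [Fintype G.vertexSet] [Fintype G.edgeSet]
    (h2 : (2 : K) ≠ 0) {w : G.edgeSet → K} (hw : w ∈ dualCode (incidenceCode K G)) (hw0 : w ≠ 0) :
    ∃ X, (IsEvenCycle G X ∨ IsBowtie G X) ∧ X ⊆ Subtype.val '' Function.support w := by
  classical
  have hedge : ∀ f ∈ Subtype.val '' Function.support w, ∀ x, G.Inc f x →
      ∃ f' ∈ Subtype.val '' Function.support w, f' ≠ f ∧ G.Inc f' x := by
    rintro _ ⟨f, hf, rfl⟩ x ⟨y, hxy⟩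
    refine exists_ne_of_mem_dualCode hw hf (x := ⟨x, hxy.left_mem⟩) ?_
    rw [incidenceMatrix_apply hxy, if_pos rfl]
    split_ifs
    · rwa [one_add_one_eq_two]
    · rw [add_zero]
      exact one_ne_zero
  obtain ⟨X, hX, h⟩ := exists_isEvenCycle_or_isBowtie hedge (Subtype.coe_image_subset _ _)
    (image_support_nonempty hw0) fun n v e h hn hH => exists_edge_off_odd_cycle h2 hw h hn hH
  exact ⟨X, h, hX⟩

/-- Two odd closed paths joined by a path, possibly of length 0, carry a word of the dual code. -/
theorem exists_mem_dualCode_of_joined [Fintype G.edgeSet] (h2 : (2 : K) ≠ 0)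
    {n₁ n₂ n₃ : ℕ} {v₁ v₂ v₃ : ℕ → α} {e₁ e₂ e₃ : ℕ → β}
    (h₁ : IsClosedPath G n₁ v₁ e₁) (h₂ : IsClosedPath G n₂ v₂ e₂) (h₃ : IsWalk G n₃ v₃ e₃)
    (hn₁ : Odd n₁) (hn₂ : Odd n₂) (he₃ : Set.InjOn e₃ (Set.Iio n₃))
    (h0 : v₃ 0 = v₁ 0) (hlast : v₃ n₃ = v₂ 0)
    (h12 : Disjoint (e₁ '' Set.Iio n₁) (e₂ '' Set.Iio n₂))
    (h13 : Disjoint (e₁ '' Set.Iio n₁) (e₃ '' Set.Iio n₃))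
    (h23 : Disjoint (e₂ '' Set.Iio n₂) (e₃ '' Set.Iio n₃)) :
    ∃ w ∈ dualCode (incidenceCode K G), w ≠ 0 ∧
      e₁ '' Set.Iio n₁ ∪ e₂ '' Set.Iio n₂ ∪ e₃ '' Set.Iio n₃ =
        Subtype.val '' Function.support w := by
  classical
  set w₁ := walkWord K G n₁ e₁ with hw₁
  set w₂ := walkWord K G n₂ e₂ with hw₂
  set w₃ := walkWord K G n₃ e₃ with hw₃
  have hs₁ := image_support_walkWord (K := K) h₁.walk h₁.edge_inj
  have hs₂ := image_support_walkWord (K := K) h₂.walk h₂.edge_inj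
  have hs₃ := image_support_walkWord (K := K) h₃ he₃
  rw [← hs₁, ← hs₂, ← hs₃]
  rw [← hs₁, ← hs₂, Set.disjoint_image_iff Subtype.val_injective, Set.disjoint_left] at h12
  rw [← hs₁, ← hs₃, Set.disjoint_image_iff Subtype.val_injective, Set.disjoint_left] at h13
  rw [← hs₂, ← hs₃, Set.disjoint_image_iff Subtype.val_injective, Set.disjoint_left] at h23
  -- The odd cycles leave twice their base vertices and the path leaves its ends with signs `1` and
  -- `-(-1) ^ n₃`; these coefficients cancel everything, and `2 ≠ 0` keeps the path in the support.
  have hsupp : Function.support w₁ ∪ Function.support w₂ ∪ Function.support w₃ =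
      Function.support (w₁ - (-1 : K) ^ n₃ • w₂ - (2 : K) • w₃) := by
    ext b
    have a12 := @h12 b
    have a13 := @h13 b
    have a23 := @h23 b
    rw [← hw₁, ← hw₂] at a12
    rw [← hw₁, ← hw₃] at a13
    rw [← hw₂, ← hw₃] at a23
    simp only [Set.mem_union, Function.mem_support, Pi.sub_apply, Pi.smul_apply,
      smul_eq_mul, not_not, ne_eq] at a12 a13 a23 ⊢
    by_cases b1 : w₁ b = 0
    · by_cases b2 : w₂ b = 0
      · simp [b1, b2, h2]
      · simp [b1, b2, a23 b2]
    · simp [b1, a12 b1, a13 b1]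
  rw [← Set.image_union, ← Set.image_union, ← hw₁, ← hw₂, ← hw₃, hsupp]
  refine ⟨_, ?_, ne_zero_of_image_support (X := _ '' _) ?_ rfl, rfl⟩
  · rw [mem_dualCode_incidenceCode]
    funext z
    simp only [Matrix.mulVec_sub, Matrix.mulVec_smul, Pi.sub_apply, Pi.smul_apply, smul_eq_mul,
      hw₁, hw₂, hw₃, mulVec_walkWord h₁.walk, mulVec_walkWord h₂.walk, mulVec_walkWord h₃,
      h₁.closed, h₂.closed, h0, hlast, hn₁.neg_one_pow, hn₂.neg_one_pow, Pi.zero_apply]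
    ring
  · rw [← hsupp, Set.image_union, Set.image_union, hs₁]
    exact (h₁.nonempty.mono Set.subset_union_left).mono Set.subset_union_left

theorem IsClosedPath.edge_notMem {n : ℕ} {v : ℕ → α} {e : ℕ → β} (h : IsClosedPath G n v e)
    {b : β} {x y : α} (hl : G.IsLink b x y) (hx : x ∉ v '' Set.Iio n) : b ∉ e '' Set.Iio n := by
  rintro ⟨k, hk, rfl⟩
  exact hx (h.mem_of_isLink hk hl)

/-- A common edge would have both ends on the cycle, hence both equal to `x`, but a path does not
repeat vertices. -/
theorem IsClosedPath.disjoint_path {n m : ℕ} {v u : ℕ → α} {e d : ℕ → β}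
    (h : IsClosedPath G n v e) (hw : IsWalk G m u d) (hu : Set.InjOn u (Set.Iic m)) {x : α}
    (hx : u '' Set.Iic m ∩ v '' Set.Iio n = {x}) :
    Disjoint (e '' Set.Iio n) (d '' Set.Iio m) := by
  rw [Set.disjoint_right]
  rintro _ ⟨k, hk, rfl⟩ hmem
  rw [Set.mem_Iio] at hk
  have hx' : ∀ i ≤ m, u i ∈ v '' Set.Iio n → u i = x := fun i hi hv => by
    have : u i ∈ u '' Set.Iic m ∩ v '' Set.Iio n := ⟨⟨i, hi, rfl⟩, hv⟩
    rwa [hx] at this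
  have h1 : u k = x := hx' k hk.le (by_contra fun hn => h.edge_notMem (hw k hk) hn hmem)
  have h2 : u (k + 1) = x := hx' (k + 1) hk
    (by_contra fun hn => h.edge_notMem (hw k hk).symm hn hmem)
  have := hu hk.le (show k + 1 ≤ m from hk) (h1.trans h2.symm)
  omega

theorem exists_mem_dualCode_of_isEvenCycle_or_isBowtie [Fintype G.edgeSet] (h2 : (2 : K) ≠ 0)
    {X : Set β} (hX : IsEvenCycle G X ∨ IsBowtie G X) :
    ∃ w ∈ dualCode (incidenceCode K G), w ≠ 0 ∧ X = Subtype.val '' Function.support w := by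
  rcases hX with ⟨n, W, hn, hX⟩ | ⟨W₁, X₁, W₂, X₂, ⟨n₁, hn₁, hc₁⟩, ⟨n₂, hn₂, hc₂⟩, hX⟩
  · obtain ⟨v, e, h, -, rfl⟩ := hX.exists_isClosedPath'
    exact exists_mem_dualCode_of_isClosedPath h hn.neg_one_pow
  · rcases hX with ⟨⟨x, hx⟩, hdisj, rfl⟩ | ⟨hdisj, x, y, W, X₃, hpath, hWx, hWy, rfl⟩
    · obtain ⟨hx1, hx2⟩ : x ∈ W₁ ∩ W₂ := hx ▸ Set.mem_singleton x
      obtain ⟨v₁, e₁, h₁, hv₁, -, rfl⟩ := hc₁.exists_isClosedPath hx1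
      obtain ⟨v₂, e₂, h₂, hv₂, -, rfl⟩ := hc₂.exists_isClosedPath hx2
      -- Two cycles with a common vertex are joined by a path of length 0; `e₁` only fills the place
      -- of its edges.
      have := exists_mem_dualCode_of_joined (n₃ := 0) (v₃ := v₁) (e₃ := e₁) h2 h₁ h₂
        (fun k hk => absurd hk (Nat.not_lt_zero k)) hn₁ hn₂ (fun k hk => absurd hk (Nat.not_lt_zero k))
        rfl (hv₁.trans hv₂.symm) hdisj (by simp) (by simp)
      simpa using this
    · have hx1 : x ∈ W₁ := (hWx ▸ Set.mem_singleton x : x ∈ W ∩ W₁).2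
      have hy2 : y ∈ W₂ := (hWy ▸ Set.mem_singleton y : y ∈ W ∩ W₂).2
      obtain ⟨v₁, e₁, h₁, hv₁, rfl, rfl⟩ := hc₁.exists_isClosedPath hx1
      obtain ⟨v₂, e₂, h₂, hv₂, rfl, rfl⟩ := hc₂.exists_isClosedPath hy2
      have : Nonempty β := ⟨e₁ 0⟩
      obtain ⟨n₃, v₃, e₃, h₃, hv0, hvn, hinj, rfl, rfl⟩ := hpath.exists_isWalk
      refine exists_mem_dualCode_of_joined h2 h₁ h₂ h₃ hn₁ hn₂ (injOn_edges_of_injOn h₃ hinj)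
        (hv0.trans hv₁.symm) (hvn.trans hv₂.symm) ?_ (h₁.disjoint_path h₃ hinj hWx)
        (h₂.disjoint_path h₃ hinj hWy)
      rw [Set.disjoint_left]
      rintro _ ⟨k, hk, rfl⟩
      exact h₂.edge_notMem (h₁.walk k hk) (Set.disjoint_left.1 hdisj ⟨k, hk, rfl⟩)

end Odd

section Dimension

theorem finrank_dualCode_add [Fintype G.edgeSet] :
    Module.finrank K (LinearMap.range (incidenceMatrix K G).mulVecLin) +
      Module.finrank K (dualCode (incidenceCode K G)) = Fintype.card G.edgeSet := by
  have h : dualCode (incidenceCode K G) = LinearMap.ker (incidenceMatrix K G).mulVecLin := by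
    ext y
    rw [mem_dualCode_incidenceCode, LinearMap.mem_ker, Matrix.mulVecLin_apply]
  rw [h, LinearMap.finrank_range_add_finrank_ker, Module.finrank_fintype_fun_eq_card]

theorem card_edgeSet_le [Fintype G.vertexSet] [Fintype G.edgeSet] :
    Fintype.card G.edgeSet ≤
      Fintype.card G.vertexSet + Module.finrank K (dualCode (incidenceCode K G)) := by
  have h1 := finrank_dualCode_add (K := K) (G := G)
  have h2 := (LinearMap.range (incidenceMatrix K G).mulVecLin).finrank_le
  rw [Module.finrank_fintype_fun_eq_card] at h2
  omega

/-- The vector `σ` is orthogonal to every column, so the rank is less than the number of vertices.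
-/
theorem card_edgeSet_lt [Fintype G.vertexSet] [Fintype G.edgeSet] {σ : α → K}
    (hV : G.vertexSet.Nonempty) (hσ0 : ∀ x, σ x ≠ 0)
    (hσ : ∀ e x y, G.IsLink e x y → σ x + σ y = 0) :
    Fintype.card G.edgeSet <
      Fintype.card G.vertexSet + Module.finrank K (dualCode (incidenceCode K G)) := by
  classical
  have h1 := finrank_dualCode_add (K := K) (G := G)
  have h2 : LinearMap.range (incidenceMatrix K G).mulVecLin ≠ ⊤ := by
    intro htop
    obtain ⟨x, hx⟩ := hV
    obtain ⟨w, hw⟩ := LinearMap.range_eq_top.1 htop (Pi.single ⟨x, hx⟩ 1)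
    rw [Matrix.mulVecLin_apply] at hw
    have h3 : (fun z : G.vertexSet => σ z) ⬝ᵥ (incidenceMatrix K G).mulVec w = 0 := by
      rw [Matrix.dotProduct_mulVec]
      refine Finset.sum_eq_zero fun b _ => ?_
      obtain ⟨x, y, hxy⟩ := G.exists_isLink_of_mem_edgeSet b.2
      rw [vecMul_incidenceMatrix _ (x := ⟨x, hxy.left_mem⟩) (y := ⟨y, hxy.right_mem⟩) hxy,
        hσ _ _ _ hxy, zero_mul]
    rw [hw, dotProduct_single, mul_one] at h3
    exact hσ0 x h3
  have h4 := Submodule.finrank_lt h2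
  rw [Module.finrank_fintype_fun_eq_card] at h4
  omega

end Dimension

end DualCode

end IncidenceCode

namespace IncidenceCode

/-! ### Cutsets as supports of words of the code. -/

section Cutsets

variable {α β : Type*} {K : Type*} [Field K] {G : Graph α β}

theorem eq_of_reachable {γ : Type*} {f : α → γ} (hf : ∀ b x y, G.IsLink b x y → f x = f y)
    {x y : G.vertexSet} (h : G.toSimpleGraph.Reachable x y) : f x = f y := by
  obtain ⟨p⟩ := h
  induction p with
  | nil => rfl
  | cons hadj _ ih =>
    obtain ⟨-, b, hb⟩ := (G.toSimpleGraph_adj _ _).mp hadj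
    exact (hf b _ _ hb).trans ih

variable (K) in
/-- A multigraph is disconnected if there is a nonconstant function on its vertices which is
constant along edges. -/
theorem one_lt_numComponents_iff [Finite G.vertexSet] :
    1 < numComponents G ↔ ∃ f : α → K, (∃ x ∈ G.vertexSet, ∃ y ∈ G.vertexSet, f x ≠ f y) ∧
      ∀ b x y, G.IsLink b x y → f x = f y := by
  classical
  rw [numComponents, Finite.one_lt_card_iff_nontrivial]
  constructor
  · rintro ⟨c, c', hcc⟩
    obtain ⟨x, rfl⟩ := c.exists_rep
    obtain ⟨y, rfl⟩ := c'.exists_rep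
    refine ⟨fun z => if ∃ h : z ∈ G.vertexSet, G.toSimpleGraph.Reachable x ⟨z, h⟩ then 1 else 0,
      ⟨x, x.2, y, y.2, ?_⟩, fun b z t hzt => ?_⟩
    · beta_reduce
      rw [if_pos ⟨x.2, .refl _⟩, if_neg]
      · exact one_ne_zero
      · rintro ⟨_, h⟩
        exact hcc (SimpleGraph.ConnectedComponent.sound h)
    · have h : G.toSimpleGraph.Reachable ⟨z, hzt.left_mem⟩ ⟨t, hzt.right_mem⟩ := by
        by_cases hne : z = t
        · subst hne
          exact .refl _
        · exact SimpleGraph.Adj.reachable ((G.toSimpleGraph_adj _ _).mpr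
            ⟨fun h => hne (congr_arg Subtype.val h), b, hzt⟩)
      refine if_congr ⟨fun ⟨_, h'⟩ => ⟨_, h'.trans h⟩, fun ⟨_, h'⟩ => ⟨_, h'.trans h.symm⟩⟩ rfl rfl
  · rintro ⟨f, ⟨x, hx, y, hy, hne⟩, hf⟩
    refine ⟨G.toSimpleGraph.connectedComponentMk ⟨x, hx⟩,
      G.toSimpleGraph.connectedComponentMk ⟨y, hy⟩, fun h => hne ?_⟩
    exact eq_of_reachable hf (SimpleGraph.ConnectedComponent.exact h)

theorem IsConnected.numComponents_eq_one (hG : IsConnected G) : numComponents G = 1 := by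
  have : Nonempty G.vertexSet := hG.nonempty
  have := hG.preconnected.subsingleton_connectedComponent
  obtain ⟨x⟩ := ‹Nonempty G.vertexSet›
  have : Nonempty G.toSimpleGraph.ConnectedComponent := ⟨G.toSimpleGraph.connectedComponentMk x⟩
  exact Nat.card_of_subsingleton (Classical.arbitrary _)

variable (K) in
theorem isCutset_iff [Finite G.vertexSet] (hG : IsConnected G) {X : Set β} :
    IsCutset G X ↔ X ⊆ G.edgeSet ∧ ∃ f : α → K,
      (∃ x ∈ G.vertexSet, ∃ y ∈ G.vertexSet, f x ≠ f y) ∧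
      ∀ b x y, G.IsLink b x y → b ∉ X → f x = f y := by
  have : Finite (G.deleteEdges X).vertexSet := ‹Finite G.vertexSet›
  rw [IsCutset, hG.numComponents_eq_one, one_lt_numComponents_iff K]
  simp only [Graph.deleteEdges_isLink, and_imp]
  rfl

variable {σ : α → K}

theorem mem_incidenceCode [Fintype G.vertexSet] {w : G.edgeSet → K} :
    w ∈ incidenceCode K G ↔ ∃ z, Matrix.vecMul z (incidenceMatrix K G) = w := by
  rw [incidenceCode, ← range_vecMulLinear]
  rfl

/-- A potential `f` that is constant along the edges outside `X` gives the word `σ x * (f x - f y)`.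
Its support is a cutset inside `X`, hence all of `X` by minimality. -/
theorem exists_mem_incidenceCode_of_isCocycle [Fintype G.vertexSet] (hG : IsConnected G)
    (hσ0 : ∀ x, σ x ≠ 0) (hσ : ∀ e x y, G.IsLink e x y → σ x + σ y = 0) {X : Set β}
    (hX : IsCocycle G X) :
    ∃ w ∈ incidenceCode K G, w ≠ 0 ∧ X = Subtype.val '' Function.support w := by
  obtain ⟨-, f, hne, hf⟩ := (isCutset_iff K hG).1 hX.prop
  set w := Matrix.vecMul (fun z : G.vertexSet => σ z * f z) (incidenceMatrix K G) with hw
  have hwb : ∀ (b : G.edgeSet) x y, G.IsLink b x y → w b = σ x * (f x - f y) := by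
    intro b x y hxy
    rw [hw, vecMul_incidenceMatrix _ (x := ⟨x, hxy.left_mem⟩) (y := ⟨y, hxy.right_mem⟩) hxy]
    linear_combination f y * hσ _ _ _ hxy
  have hcut : IsCutset G (Subtype.val '' Function.support w) := by
    refine (isCutset_iff K hG).2 ⟨?_, f, hne, fun b x y hxy hb => ?_⟩
    · rintro _ ⟨b, -, rfl⟩
      exact b.2
    · have h0 : w ⟨b, hxy.edge_mem⟩ = 0 := by_contra fun h => hb ⟨_, h, rfl⟩
      rw [hwb _ x y hxy] at h0
      exact sub_eq_zero.1 ((mul_eq_zero.1 h0).resolve_left (hσ0 x))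
  have hsub : Subtype.val '' Function.support w ⊆ X := by
    rintro _ ⟨b, hb, rfl⟩
    obtain ⟨x, y, hxy⟩ := G.exists_isLink_of_mem_edgeSet b.2
    by_contra hbX
    exact hb (by rw [hwb b x y hxy, hf _ _ _ hxy hbX, sub_self, mul_zero])
  refine ⟨w, mem_incidenceCode.2 ⟨_, rfl⟩, fun h0 => ?_, (hX.eq_of_subset hcut hsub).symm⟩
  -- If `w = 0`, the cutset would be empty, but removing nothing creates no new component.
  have := hcut.2
  simp [h0] at this

theorem exists_isCocycle_of_mem_incidenceCode [Fintype G.vertexSet] [Finite G.edgeSet]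
    (hG : IsConnected G) (hσ0 : ∀ x, σ x ≠ 0)
    (hσ : ∀ e x y, G.IsLink e x y → σ x + σ y = 0) {w : G.edgeSet → K}
    (hw : w ∈ incidenceCode K G) (hw0 : w ≠ 0) :
    ∃ X, IsCocycle G X ∧ X ⊆ Subtype.val '' Function.support w := by
  classical
  obtain ⟨z, rfl⟩ := mem_incidenceCode.1 hw
  -- Dividing by `σ` recovers the potential; its value outside the vertex set plays no role.
  set f : α → K := fun x => if h : x ∈ G.vertexSet then z ⟨x, h⟩ / σ x else 0 with hf
  have hwb : ∀ (b : G.edgeSet) x y, G.IsLink b x y →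
      Matrix.vecMul z (incidenceMatrix K G) b = σ x * (f x - f y) := by
    intro b x y hxy
    have hy : σ x = -σ y := eq_neg_of_add_eq_zero_left (hσ _ _ _ hxy)
    rw [vecMul_incidenceMatrix _ (x := ⟨x, hxy.left_mem⟩) (y := ⟨y, hxy.right_mem⟩) hxy, mul_sub,
      hf]
    simp only [hxy.left_mem, hxy.right_mem, dif_pos]
    rw [mul_div_cancel₀ _ (hσ0 x), hy, neg_mul, mul_div_cancel₀ _ (hσ0 y), sub_neg_eq_add]
  have hcut : IsCutset G (Subtype.val '' Function.support
      (Matrix.vecMul z (incidenceMatrix K G))) := by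
    refine (isCutset_iff K hG).2 ⟨?_, f, ?_, fun b x y hxy hb => ?_⟩
    · rintro _ ⟨b, -, rfl⟩
      exact b.2
    · obtain ⟨b, hb⟩ := Function.ne_iff.1 hw0
      obtain ⟨x, y, hxy⟩ := G.exists_isLink_of_mem_edgeSet b.2
      refine ⟨x, hxy.left_mem, y, hxy.right_mem, fun h => hb ?_⟩
      rw [hwb b x y hxy, h, sub_self, mul_zero, Pi.zero_apply]
    · have h0 : Matrix.vecMul z (incidenceMatrix K G) ⟨b, hxy.edge_mem⟩ = 0 :=
        by_contra fun h => hb ⟨_, h, rfl⟩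
      rw [hwb _ x y hxy] at h0
      exact sub_eq_zero.1 ((mul_eq_zero.1 h0).resolve_left (hσ0 x))
  have hfin : {X | IsCutset G X}.Finite :=
    (Set.toFinite G.edgeSet).finite_subsets.subset fun X hX => hX.1
  obtain ⟨X, hXle, hX⟩ := hfin.exists_le_minimal hcut
  exact ⟨X, hX, hXle⟩

/-- If `z` kills all columns, then `z / σ` is constant along edges, hence constant by connectedness;
so the left kernel is at most a line. -/
theorem card_vertexSet_le [Fintype G.vertexSet] (hG : IsConnected G)
    (hσ0 : ∀ x, σ x ≠ 0) (hσ : ∀ e x y, G.IsLink e x y → σ x + σ y = 0) :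
    Fintype.card G.vertexSet ≤ Module.finrank K (incidenceCode K G) + 1 := by
  classical
  have h1 := (incidenceMatrix K G).vecMulLinear.finrank_range_add_finrank_ker
  rw [range_vecMulLinear, Module.finrank_fintype_fun_eq_card] at h1
  have h2 : Module.finrank K (LinearMap.ker (incidenceMatrix K G).vecMulLinear) ≤ 1 := by
    have hker : LinearMap.ker (incidenceMatrix K G).vecMulLinear ≤
        K ∙ (fun z : G.vertexSet => σ z) := by
      intro z hz
      have hz' : Matrix.vecMul z (incidenceMatrix K G) = 0 := hz
      have hconst : ∀ x y : G.vertexSet, z x / σ x = z y / σ y := by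
        intro x y
        have := eq_of_reachable (G := G)
          (f := fun x => if h : x ∈ G.vertexSet then z ⟨x, h⟩ / σ x else 0) ?_
          (hG.preconnected x y)
        · simpa using this
        · intro b x y hxy
          have h0 := congr_fun hz' ⟨b, hxy.edge_mem⟩
          rw [vecMul_incidenceMatrix _ (x := ⟨x, hxy.left_mem⟩) (y := ⟨y, hxy.right_mem⟩) hxy,
            Pi.zero_apply] at h0
          simp only [hxy.left_mem, hxy.right_mem, dif_pos]
          rw [eq_neg_of_add_eq_zero_left h0, eq_neg_of_add_eq_zero_left (hσ _ _ _ hxy),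
            neg_div_neg_eq]
      obtain ⟨x⟩ := hG.nonempty
      refine Submodule.mem_span_singleton.2 ⟨z x / σ x, funext fun y => ?_⟩
      rw [Pi.smul_apply, smul_eq_mul, hconst x y, div_mul_cancel₀ _ (hσ0 y)]
    exact (Submodule.finrank_mono hker).trans ((finrank_span_le_card _).trans (by simp))
  rw [incidenceCode]
  omega

end Cutsets

/-- If the characteristic is 2 or the multigraph is bipartite, its vertices have signs such that
the ends of an edge have opposite signs. -/
theorem exists_signs {α β : Type*} (K : Type*) [Field K] (p : ℕ) [CharP K p] {G : Graph α β}
    (h : p = 2 ∨ IsBipartite G) :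
    ∃ σ : α → K, (∀ x, σ x ≠ 0) ∧ ∀ e x y, G.IsLink e x y → σ x + σ y = 0 := by
  classical
  rcases h with rfl | ⟨A, hA⟩
  · exact ⟨fun _ => 1, fun _ => one_ne_zero, fun _ _ _ _ => CharTwo.add_self_eq_zero 1⟩
  · refine ⟨fun x => if x ∈ A then 1 else -1, fun x => ?_, fun e x y hxy => ?_⟩
    · simp only
      split_ifs <;> simp
    · have := hA e x y hxy
      by_cases hy : y ∈ A <;> simp [this, hy]

end IncidenceCode

/-! ### The three weight formulas. -/

open IncidenceCode in
theorem mainTheorem11 {α β K : Type*} [Field K] [Finite K] (p : ℕ) [CharP K p]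
    (G : Graph α β) [Fintype G.vertexSet] [Fintype G.edgeSet] (hG : IsConnected G)
    (s m : ℕ) (hs : s = Fintype.card G.vertexSet) (hm : m = Fintype.card G.edgeSet) :
    ((p = 2 ∨ IsBipartite G) →
      (∀ r : ℕ, 1 ≤ r → r + s ≤ m + 1 →
        IsLeast (unionSizes (IsCycle G) r) (ghw (dualCode (incidenceCode K G)) r)) ∧
      (∀ r : ℕ, 1 ≤ r → r + 1 ≤ s →
        IsLeast (unionSizes (IsCocycle G) r) (ghw (incidenceCode K G) r))) ∧
    (p ≠ 2 →
      ∀ r : ℕ, 1 ≤ r → r + s ≤ m →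
        IsLeast (unionSizes (fun X => IsEvenCycle G X ∨ IsBowtie G X) r)
          (ghw (dualCode (incidenceCode K G)) r)) := by
  refine ⟨fun h => ?_, fun hp r _ hr => ?_⟩
  · obtain ⟨σ, hσ0, hσ⟩ := exists_signs K p h
    refine ⟨fun r _ hr => ?_, fun r _ hr => ?_⟩
    · have := card_edgeSet_lt (Set.nonempty_coe_sort.1 hG.nonempty) hσ0 hσ
      have hdim : r ≤ Module.finrank K (dualCode (incidenceCode K G)) := by omega
      exact isLeast_unionSizes_ghw Subtype.val_injective
        (fun X hX => exists_mem_dualCode_of_isCycle hσ0 hσ hX)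
        (fun w hw hw0 => exists_isCycle_of_mem_dualCode hw hw0) hdim
    · have := card_vertexSet_le hG hσ0 hσ
      have hdim : r ≤ Module.finrank K (incidenceCode K G) := by omega
      exact isLeast_unionSizes_ghw Subtype.val_injective
        (fun X hX => exists_mem_incidenceCode_of_isCocycle hG hσ0 hσ hX)
        (fun w hw hw0 => exists_isCocycle_of_mem_incidenceCode hG hσ0 hσ hw hw0) hdim
  · have h2 : (2 : K) ≠ 0 := Ring.two_ne_zero (by rwa [ringChar.eq K p])
    have := card_edgeSet_le (K := K) (G := G)
    have hdim : r ≤ Module.finrank K (dualCode (incidenceCode K G)) := by omega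
    exact isLeast_unionSizes_ghw Subtype.val_injective
      (fun X hX => exists_mem_dualCode_of_isEvenCycle_or_isBowtie h2 hX)
      (fun w hw hw0 => exists_isEvenCycle_or_isBowtie_of_mem_dualCode h2 hw hw0) hdim
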